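/- Let $\mathcal{E}$ be an order complete vector lattice with a weak unit $E$, let $K$ be an extremally disconnected compact Hausdorff space, and let $C^\infty(K)$ be the vector lattice of continuous functions $K\to[-\infty,\infty]$ that are finite off a nowhere dense set, with operations taken pointwise off nowhere dense sets. Fix a (Maeda–Ogasawara) representation of $\mathcal{E}$ as an order dense ideal of $C^\infty(K)$ in which $E$ corresponds to the constant function $1$; then $\mathcal{E}^u=C^\infty(K)$ is the universal completion of $\mathcal{E}$, and $\mathcal{E}^s=\{u\in C(K,[-\infty,\infty]): u\ge g\text{ for some }g\in\mathcal{E}\}$ is its sup-completion. For $X\in\mathcal{E}$ let $A_t=E-P_{(X-tE)^+}E$ $(t\in\mathbb{R})$, where $P_Y$ is the band projection onto the band generated by $Y$, and let $A_{\infty}=\sup_t A_t$, $A_{-\infty}=\inf_t A_t$. Put $\mu_A((a,b]\cap\mathbb{R})=A_b-A_a$ for $-\infty\le a<b\le\infty$, extend $\mu_A$ additively to the algebra $F(\mathbb{R})$ of finite disjoint unions of such intervals, and let $I(\sum_i a_i\mathbf{1}_{S_i})=\sum_i a_i\mu_A(S_i)$ for step functions ($(S_i)$ a finite partition of $\mathbb{R}$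 into sets of $F(\mathbb{R})$). If step functions $f_n$ increase pointwise to $f:\mathbb{R}\to[-\infty,\infty]$, let $I(f)=\sup_n I(f_n)\in\mathcal{E}^s$. If $f=g-h$, where $g,h\ge 0$ are real-valued pointwise increasing limits of step functions with $I(g),I(h)\in\mathcal{E}^u$, let $f(X):=I(f):=I(g)-I(h)\in\mathcal{E}^u$ (the Daniell functional calculus). A sequence $(y_n)$ in a vector lattice converges to $y$ in unbounded order if for every $u\ge 0$ the sequence $|y_n-y|\wedge u$ converges to $0$ in order, i.e. is dominated by a sequence decreasing to $0$. Let $f:\mathbb{R}\to\mathbb{R}$ be continuous. Then $f(X)\in\mathcal{E}^u$ is well defined for every $X\in\mathcal{E}$ (a decomposition $f=g-h$ as above exists, and the value does not depend on any choice), and if a sequence $(x_n)$ in $\mathcal{E}$ converges to $x\in\mathcal{E}$ in unbounded order in $\mathcal{E}$, then $f(x_n)$ converges to $f(x)$ in unbounded order in $\mathcal{E}^u$. -/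

import Mathlib

open Set Filter Topology

/-! ### The vector lattice `C^∞(K)` -/

noncomputable section CInf

/-- `C^∞(K)`: the continuous functions from `K` to `[-∞, ∞]` that are finite outside a nowhere
dense set. Two continuous functions that differ only on a nowhere dense set are equal, so
no quotient is needed. -/
def CInf (K : Type*) [TopologicalSpace K] : Type _ :=
  {f : C(K, EReal) // IsNowhereDense {ω | f ω = ⊥ ∨ f ω = ⊤}}

namespace CInf

section Basic

variable {K : Type*} [TopologicalSpace K]

instance : FunLike (CInf K) K EReal where
  coe f := f.1
  coe_injective _ _ h := Subtype.ext (DFunLike.coe_injective h)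

/-- The set of points where `f` is finite. -/
def fin (f : CInf K) : Set K := {ω | f ω = ⊥ ∨ f ω = ⊤}ᶜ

theorem continuous (f : CInf K) : Continuous f := f.1.continuous

theorem isClosed_infinite (f : C(K, EReal)) : IsClosed {ω | f ω = ⊥ ∨ f ω = ⊤} :=
  (isClosed_singleton.preimage f.continuous).union (isClosed_singleton.preimage f.continuous)

theorem isOpen_fin (f : CInf K) : IsOpen f.fin :=
  (isClosed_isNowhereDense_iff_compl.1 ⟨isClosed_infinite f.1, f.2⟩).1

theorem dense_fin (f : CInf K) : Dense f.fin :=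
  (isClosed_isNowhereDense_iff_compl.1 ⟨isClosed_infinite f.1, f.2⟩).2

theorem continuousOn_toReal (f : CInf K) : ContinuousOn (fun ω => (f ω).toReal) f.fin :=
  EReal.continuousOn_toReal.comp f.continuous.continuousOn (fun ω hω => by
    simpa [fin] using hω)

theorem isNowhereDense_of_finite_on {f : C(K, EReal)} {U : Set K} (hU : IsOpen U) (hd : Dense U)
    (h : ∀ ω ∈ U, f ω ≠ ⊥ ∧ f ω ≠ ⊤) : IsNowhereDense {ω | f ω = ⊥ ∨ f ω = ⊤} := by
  have : IsNowhereDense Uᶜ := by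
    refine (isClosed_isNowhereDense_iff_compl.2 ?_).2
    rw [compl_compl]
    exact ⟨hU, hd⟩
  refine this.mono ?_
  intro ω hω hωU
  rcases hω with hω | hω
  · exact (h ω hωU).1 hω
  · exact (h ω hωU).2 hω

/-- `C^∞(K)` carries the pointwise order and the pointwise lattice operations. -/
instance : Lattice (CInf K) :=
  Subtype.lattice
    (fun {f g} hf hg => isNowhereDense_of_finite_on
      (isOpen_fin (⟨f, hf⟩ : CInf K) |>.inter (isOpen_fin (⟨g, hg⟩ : CInf K)))
      ((dense_fin (⟨f, hf⟩ : CInf K)).inter_of_isOpen_left (dense_fin (⟨g, hg⟩ : CInf K))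
        (isOpen_fin (⟨f, hf⟩ : CInf K)))
      (by
        rintro ω ⟨h1, h2⟩
        simp only [fin, mem_compl_iff, mem_ofPred_eq, not_or] at h1 h2
        rw [ContinuousMap.sup_apply]
        rcases max_choice (f ω) (g ω) with h | h <;> rw [h]
        exacts [h1, h2]))
    (fun {f g} hf hg => isNowhereDense_of_finite_on
      (isOpen_fin (⟨f, hf⟩ : CInf K) |>.inter (isOpen_fin (⟨g, hg⟩ : CInf K)))
      ((dense_fin (⟨f, hf⟩ : CInf K)).inter_of_isOpen_left (dense_fin (⟨g, hg⟩ : CInf K))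
        (isOpen_fin (⟨f, hf⟩ : CInf K)))
      (by
        rintro ω ⟨h1, h2⟩
        simp only [fin, mem_compl_iff, mem_ofPred_eq, not_or] at h1 h2
        rw [ContinuousMap.inf_apply]
        rcases min_choice (f ω) (g ω) with h | h <;> rw [h]
        exacts [h1, h2]))

theorem le_def {f g : CInf K} : f ≤ g ↔ ∀ ω, f ω ≤ g ω := Iff.rfl

theorem sup_apply (f g : CInf K) (ω : K) : (f ⊔ g) ω = f ω ⊔ g ω := rfl

theorem inf_apply (f g : CInf K) (ω : K) : (f ⊓ g) ω = f ω ⊓ g ω := rfl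

/-- A constant function with a real value. -/
def const (K : Type*) [TopologicalSpace K] (r : ℝ) : CInf K :=
  ⟨ContinuousMap.const K (r : EReal), by simp⟩

instance : Zero (CInf K) := ⟨const K 0⟩

instance : One (CInf K) := ⟨const K 1⟩

theorem zero_apply (ω : K) : (0 : CInf K) ω = ((0 : ℝ) : EReal) := rfl

theorem one_apply (ω : K) : (1 : CInf K) ω = ((1 : ℝ) : EReal) := rfl

theorem fin_ae (f : CInf K) : ∀ᶠ ω in residual K, ∃ r : ℝ, f ω = r := by
  filter_upwards [residual_of_dense_open f.isOpen_fin f.dense_fin] with ω hω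
  simp only [fin, mem_compl_iff, mem_ofPred_eq, not_or] at hω
  exact ⟨(f ω).toReal, (EReal.coe_toReal hω.2 hω.1).symm⟩

theorem le_of_ae [BaireSpace K] {f g : CInf K} (h : ∀ᶠ ω in residual K, f ω ≤ g ω) : f ≤ g := by
  have hd : Dense {ω | f ω ≤ g ω} := dense_of_mem_residual h
  have hc : IsClosed {ω | f ω ≤ g ω} := isClosed_le f.continuous g.continuous
  intro ω
  have : ω ∈ {ω | f ω ≤ g ω} := by
    rw [← hc.closure_eq, hd.closure_eq]; trivial
  exact this

theorem eq_of_ae [BaireSpace K] {f g : CInf K} (h : ∀ᶠ ω in residual K, f ω = g ω) : f = g :=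
  le_antisymm (le_of_ae (h.mono fun _ h => h.le)) (le_of_ae (h.mono fun _ h => h.ge))

end Basic

variable {K : Type*} [TopologicalSpace K] [CompactSpace K] [T2Space K] [ExtremallyDisconnected K]

/-- A real-valued function that is continuous on a dense open subset of an extremally disconnected
compact Hausdorff space extends from there to an element of `C^∞(K)`. -/
theorem exists_extension {U : Set K} (hU : IsOpen U) (hd : Dense U) {F : K → ℝ}
    (hF : ContinuousOn F U) : ∃ f : CInf K, ∀ ω ∈ U, f ω = (F ω : EReal) := by
  let G : Set (K × EReal) := (fun ω => (ω, (F ω : EReal))) '' U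
  let C : Set (K × EReal) := closure G
  have hCc : IsCompact C := isClosed_closure.isCompact
  have : CompactSpace C := isCompact_iff_compactSpace.1 hCc
  have hsurj : Function.Surjective (fun c : C => c.1.1) := by
    have himg : IsClosed (Prod.fst '' C) := (hCc.image continuous_fst).isClosed
    have hsub : U ⊆ Prod.fst '' C := fun ω hω =>
      ⟨(ω, (F ω : EReal)), subset_closure ⟨ω, hω, rfl⟩, rfl⟩
    intro ω
    have : ω ∈ Prod.fst '' C := by
      have := himg.closure_subset_iff.2 hsub
      rw [hd.closure_eq] at this
      exact this trivial
    obtain ⟨c, hc, rfl⟩ := this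
    exact ⟨⟨c, hc⟩, rfl⟩
  obtain ⟨s, hs, hgs⟩ := CompactT2.ExtremallyDisconnected.projective (A := K)
    (continuous_id (X := K)) (continuous_fst.comp (continuous_subtype_val (p := (· ∈ C)))) hsurj
  have hs1 : ∀ ω, (s ω).1.1 = ω := fun ω => congrFun hgs ω
  have key : ∀ c ∈ C, c.1 ∈ U → c.2 = (F c.1 : EReal) := by
    rintro ⟨ω, r⟩ hc hω
    simp only at hω ⊢
    by_contra hne
    obtain ⟨V, W, hV, hW, hrV, hFW, hVW⟩ := t2_separation hne
    have hcont : ContinuousOn (fun ω => (F ω : EReal)) U :=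
      continuous_coe_real_ereal.comp_continuousOn hF
    have hO : IsOpen (U ∩ (fun ω => (F ω : EReal)) ⁻¹' W) := hcont.isOpen_inter_preimage hU hW
    obtain ⟨p, ⟨hp1, hp2⟩, ⟨ω', hω', rfl⟩⟩ := mem_closure_iff.1 hc _ (hO.prod hV)
      ⟨⟨hω, hFW⟩, hrV⟩
    exact disjoint_left.1 hVW hp2 hp1.2
  let f : C(K, EReal) := ⟨fun ω => (s ω).1.2, continuous_snd.comp (continuous_subtype_val.comp hs)⟩
  have hf : ∀ ω ∈ U, f ω = (F ω : EReal) := by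
    intro ω hω
    have := key (s ω).1 (s ω).2 (by rw [hs1]; exact hω)
    rw [hs1] at this
    exact this
  exact ⟨⟨f, isNowhereDense_of_finite_on hU hd fun ω hω => by rw [hf ω hω]; simp⟩, hf⟩

/-- The element of `C^∞(K)` that extends `F` from the dense open set `U`. -/
def extend {U : Set K} (hU : IsOpen U) (hd : Dense U) {F : K → ℝ}
    (hF : ContinuousOn F U) : CInf K :=
  (exists_extension hU hd hF).choose

theorem extend_apply {U : Set K} (hU : IsOpen U) (hd : Dense U) {F : K → ℝ}
    (hF : ContinuousOn F U) : ∀ ω ∈ U, extend hU hd hF ω = (F ω : EReal) :=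
  (exists_extension hU hd hF).choose_spec

/-! Addition, negation and scalar multiplication are pointwise on the dense open set where all
functions involved are finite, and are extended continuously from there. -/

instance : Add (CInf K) :=
  ⟨fun f g => extend (f.isOpen_fin.inter g.isOpen_fin)
    (f.dense_fin.inter_of_isOpen_left g.dense_fin f.isOpen_fin)
    (F := fun ω => (f ω).toReal + (g ω).toReal)
    ((f.continuousOn_toReal.mono inter_subset_left).add
      (g.continuousOn_toReal.mono inter_subset_right))⟩

instance : SMul ℝ (CInf K) :=
  ⟨fun c f => extend f.isOpen_fin f.dense_fin (F := fun ω => c * (f ω).toReal)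
    (f.continuousOn_toReal.const_smul c)⟩

instance : Neg (CInf K) :=
  ⟨fun f => extend f.isOpen_fin f.dense_fin (F := fun ω => - (f ω).toReal)
    f.continuousOn_toReal.neg⟩

theorem add_ae (f g : CInf K) : ∀ᶠ ω in residual K,
    (f + g) ω = (((f ω).toReal + (g ω).toReal : ℝ) : EReal) := by
  filter_upwards [residual_of_dense_open f.isOpen_fin f.dense_fin,
    residual_of_dense_open g.isOpen_fin g.dense_fin] with ω h1 h2
  exact extend_apply _ _ _ ω ⟨h1, h2⟩

theorem smul_ae (c : ℝ) (f : CInf K) : ∀ᶠ ω in residual K,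
    (c • f) ω = ((c * (f ω).toReal : ℝ) : EReal) := by
  filter_upwards [residual_of_dense_open f.isOpen_fin f.dense_fin] with ω h1
  exact extend_apply _ _ _ ω h1

theorem neg_ae (f : CInf K) : ∀ᶠ ω in residual K,
    (-f) ω = ((-(f ω).toReal : ℝ) : EReal) := by
  filter_upwards [residual_of_dense_open f.isOpen_fin f.dense_fin] with ω h1
  exact extend_apply _ _ _ ω h1

instance : AddCommGroup (CInf K) where
  add_assoc f g h := eq_of_ae <| by
    filter_upwards [add_ae (f + g) h, add_ae f g, add_ae f (g + h), add_ae g h]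
      with ω h1 h2 h3 h4
    rw [h1, h2, h3, h4, EReal.toReal_coe, EReal.toReal_coe, add_assoc]
  zero_add f := eq_of_ae <| by
    filter_upwards [add_ae 0 f, fin_ae f] with ω h1 ⟨r, hr⟩
    rw [h1, hr, zero_apply, EReal.toReal_coe, EReal.toReal_coe, zero_add]
  add_zero f := eq_of_ae <| by
    filter_upwards [add_ae f 0, fin_ae f] with ω h1 ⟨r, hr⟩
    rw [h1, hr, zero_apply, EReal.toReal_coe, EReal.toReal_coe, add_zero]
  add_comm f g := eq_of_ae <| by
    filter_upwards [add_ae f g, add_ae g f] with ω h1 h2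
    rw [h1, h2, add_comm]
  neg_add_cancel f := eq_of_ae <| by
    filter_upwards [add_ae (-f) f, neg_ae f] with ω h1 h2
    rw [h1, h2, zero_apply, EReal.toReal_coe, neg_add_cancel]
  nsmul := nsmulRec
  zsmul := zsmulRec

instance : Module ℝ (CInf K) where
  one_smul f := eq_of_ae <| by
    filter_upwards [smul_ae 1 f, fin_ae f] with ω h1 ⟨r, hr⟩
    rw [h1, hr, EReal.toReal_coe, one_mul]
  mul_smul a b f := eq_of_ae <| by
    filter_upwards [smul_ae (a * b) f, smul_ae a (b • f), smul_ae b f] with ω h1 h2 h3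
    rw [h1, h2, h3, EReal.toReal_coe, mul_assoc]
  smul_zero a := eq_of_ae <| by
    filter_upwards [smul_ae a (0 : CInf K)] with ω h1
    rw [h1, zero_apply, EReal.toReal_coe, mul_zero]
  smul_add a f g := eq_of_ae <| by
    filter_upwards [smul_ae a (f + g), add_ae f g, add_ae (a • f) (a • g), smul_ae a f,
      smul_ae a g] with ω h1 h2 h3 h4 h5
    rw [h1, h2, h3, h4, h5, EReal.toReal_coe, EReal.toReal_coe, EReal.toReal_coe, mul_add]
  add_smul a b f := eq_of_ae <| by
    filter_upwards [smul_ae (a + b) f, add_ae (a • f) (b • f), smul_ae a f,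
      smul_ae b f] with ω h1 h2 h3 h4
    rw [h1, h2, h3, h4, EReal.toReal_coe, EReal.toReal_coe, add_mul]
  zero_smul f := eq_of_ae <| by
    filter_upwards [smul_ae 0 f] with ω h1
    rw [h1, zero_apply, zero_mul]

instance : IsOrderedAddMonoid (CInf K) where
  add_le_add_left f g h k := le_of_ae <| by
    filter_upwards [add_ae f k, add_ae g k, fin_ae f, fin_ae g] with ω h1 h2 ⟨r, hr⟩ ⟨s, hs⟩
    have := le_def.1 h ω
    rw [hr, hs, EReal.coe_le_coe_iff] at this
    rw [h1, h2, hr, hs, EReal.toReal_coe, EReal.toReal_coe, EReal.coe_le_coe_iff]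
    linarith

end CInf

end CInf

/-! ### Order notions in vector lattices -/

section VectorLattice

/-- Order convergence of a sequence: `|x n - x₀|` is dominated by a sequence decreasing
to `0`. -/
def OrderTendsto {G : Type*} [Lattice G] [AddCommGroup G] (x : ℕ → G) (x₀ : G) : Prop :=
  ∃ z : ℕ → G, Antitone z ∧ IsGLB (range z) 0 ∧ ∀ n, |x n - x₀| ≤ z n

/-- Unbounded order convergence of a sequence. -/
def UOTendsto {G : Type*} [Lattice G] [AddCommGroup G] (x : ℕ → G) (x₀ : G) : Prop :=
  ∀ u : G, 0 ≤ u → OrderTendsto (fun n => |x n - x₀| ⊓ u) 0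

/-- `e` is a weak (order) unit: a positive element disjoint from no nonzero element. -/
def IsWeakUnit {G : Type*} [Lattice G] [AddCommGroup G] (e : G) : Prop :=
  0 ≤ e ∧ ∀ x : G, |x| ⊓ e = 0 → x = 0

/-- Bands: solid linear subspaces that are closed under existing suprema. -/
structure IsBand {G : Type*} [Lattice G] [AddCommGroup G] [Module ℝ G]
    (B : Submodule ℝ G) : Prop where
  solid : ∀ x y : G, |x| ≤ |y| → y ∈ B → x ∈ B
  isLUB_mem : ∀ (S : Set G) (s : G), S ⊆ B → IsLUB S s → s ∈ B

/-- The band generated by `y`. -/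
def bandGen {G : Type*} [Lattice G] [AddCommGroup G] [Module ℝ G] (y : G) : Submodule ℝ G :=
  sInf {B : Submodule ℝ G | IsBand B ∧ y ∈ B}

/-- `p` is the component of `z` in the band generated by `y`: `p` lies in that band, and
`z - p` is disjoint from it. -/
def IsBandComponent {G : Type*} [Lattice G] [AddCommGroup G] [Module ℝ G] (y z p : G) : Prop :=
  p ∈ bandGen y ∧ ∀ b ∈ bandGen y, |z - p| ⊓ |b| = 0

open Classical in
/-- The band projection `P_y z` of `z` onto the band generated by `y`; in an order
complete vector lattice every band is a projection band, so the component exists. -/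
noncomputable def bandProj {G : Type*} [Lattice G] [AddCommGroup G] [Module ℝ G] (y z : G) : G :=
  if h : ∃ p, IsBandComponent y z p then h.choose else 0

end VectorLattice

/-! ### The spectral system of an element and its Daniell integral on step functions -/

section StepFunctions

variable {E : Type*} [ConditionallyCompleteLattice E] [AddCommGroup E] [Module ℝ E]

/-- The right continuous spectral system `A_t = e - P_{(X - t e)⁺} e` of `X`. -/
noncomputable def spectralSystem (e X : E) (t : ℝ) : E := e - bandProj ((X - t • e)⁺) e

/-- The spectral system extended by `A_{-∞} = inf_t A_t` and `A_∞ = sup_t A_t`. -/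
noncomputable def spectralSystemExt (e X : E) (s : EReal) : E :=
  if s = ⊥ then ⨅ t : ℝ, spectralSystem e X t
  else if s = ⊤ then ⨆ t : ℝ, spectralSystem e X t
  else spectralSystem e X s.toReal

/-- For `a < b` in `[-∞, ∞]`: the real interval `(a, b]`, `(a, ∞)`, `(-∞, b]` or `(-∞, ∞)`. -/
def halfOpen (a b : EReal) : Set ℝ := {t : ℝ | a < (t : EReal) ∧ (t : EReal) ≤ b}

/-- `S` is a finite disjoint union of intervals `(a i, b i]` (so `S` lies in the algebra `F(ℝ)`)
and `m = ∑ i, (A_{b i} - A_{a i})` is its measure `μ_A(S)` with respect to the spectral system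
of `X`. -/
def HasSpectralMeasure (e X : E) (S : Set ℝ) (m : E) : Prop :=
  ∃ (n : ℕ) (a b : Fin n → EReal),
    (∀ i, a i < b i) ∧
    Pairwise (fun i j => Disjoint (halfOpen (a i) (b i)) (halfOpen (a j) (b j))) ∧
    S = ⋃ i, halfOpen (a i) (b i) ∧
    m = ∑ i, (spectralSystemExt e X (b i) - spectralSystemExt e X (a i))

/-- `f = ∑ i, c i · 1_{S i}` is a step function over a partition of `ℝ` into finitely many sets of
`F(ℝ)` (so `f` lies in `𝕃`), and `y = ∑ i, c i • μ_A(S i)` is its integral `I(f)`. -/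
def HasStepIntegral (e X : E) (f : ℝ → ℝ) (y : E) : Prop :=
  ∃ (n : ℕ) (c : Fin n → ℝ) (S : Fin n → Set ℝ) (m : Fin n → E),
    Pairwise (fun i j => Disjoint (S i) (S j)) ∧
    (⋃ i, S i) = univ ∧
    (∀ i, HasSpectralMeasure e X (S i) (m i)) ∧
    (∀ t, f t = ∑ i, (S i).indicator (fun _ => c i) t) ∧
    y = ∑ i, c i • m i

end StepFunctions

/-! ### Maeda–Ogasawara representations and the Daniell functional calculus -/

noncomputable section Calculus

variable {E : Type*} [ConditionallyCompleteLattice E] [AddCommGroup E] [Module ℝ E]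
  {K : Type*} [TopologicalSpace K] [CompactSpace K] [T2Space K] [ExtremallyDisconnected K]

/-- A representation of the vector lattice `E` as an order dense ideal of `C^∞(K)`
in which `e` corresponds to the constant function `1`. -/
structure MaedaOgasawaraRep (e : E) (K : Type*) [TopologicalSpace K] [CompactSpace K] [T2Space K]
    [ExtremallyDisconnected K] where
  toLin : E →ₗ[ℝ] CInf K
  injective : Function.Injective toLin
  map_sup : ∀ x y : E, toLin (x ⊔ y) = toLin x ⊔ toLin y
  order_dense : ∀ g : CInf K, 0 < g → ∃ x : E, 0 < toLin x ∧ toLin x ≤ g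
  ideal : ∀ (g : CInf K) (x : E), |g| ≤ |toLin x| → ∃ y : E, toLin y = g
  map_unit : toLin e = 1

namespace MaedaOgasawaraRep

variable {e : E} (R : MaedaOgasawaraRep e K)

/-- The sup-completion `E^s`: all continuous functions from `K` to `[-∞, ∞]` that dominate some
element of `E`, with the pointwise order. -/
def SupCompletion : Type _ := {u : C(K, EReal) // ∃ x : E, ∀ ω, R.toLin x ω ≤ u ω}

instance : PartialOrder R.SupCompletion := Subtype.partialOrder _

/-- The inclusion of `E` into `E^s`. -/
def toSup (x : E) : R.SupCompletion := ⟨(R.toLin x).1, x, fun _ => le_rfl⟩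

/-- `f : ℝ → [-∞, ∞]` is the pointwise limit of an increasing sequence of step functions (so `f`
lies in `𝕃^↑`), and `u` is the supremum in `E^s` of their integrals, that is `u = I(f)`. -/
def HasUpperIntegral (X : E) (f : ℝ → EReal) (u : R.SupCompletion) : Prop :=
  ∃ (F : ℕ → ℝ → ℝ) (y : ℕ → E),
    (∀ n, HasStepIntegral e X (F n) (y n)) ∧
    (∀ t, Monotone fun n => F n t) ∧
    (∀ t, IsLUB (range fun n => (F n t : EReal)) (f t)) ∧
    IsLUB (range fun n => R.toSup (y n)) u

/-- `f = g - h` with positive real-valued `g, h` in `𝕃^↑` whose integrals `v = I(g)`, `w = I(h)` lie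
in the universal completion `E^u = C^∞(K)` (so `f` lies in `𝕃_u`), and `y = I(g) - I(h)` is the
Daniell integral `I(f)` with respect to the spectral system of `X`. -/
def HasDaniellIntegral (X : E) (f : ℝ → ℝ) (y : CInf K) : Prop :=
  ∃ (g h : ℝ → ℝ) (v w : CInf K) (v' w' : R.SupCompletion),
    (∀ t, 0 ≤ g t) ∧ (∀ t, 0 ≤ h t) ∧ (∀ t, f t = g t - h t) ∧
    R.HasUpperIntegral X (fun t => (g t : EReal)) v' ∧ v'.1 = v.1 ∧
    R.HasUpperIntegral X (fun t => (h t : EReal)) w' ∧ w'.1 = w.1 ∧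
    y = v - w

open Classical in
/-- The Daniell functional calculus `f(X) = I(f)`, with values in `E^u = C^∞(K)`. -/
def funCalc (f : ℝ → ℝ) (X : E) : CInf K :=
  if h : ∃ y, R.HasDaniellIntegral X f y then h.choose else 0

end MaedaOgasawaraRep

end Calculus

/-!
Every identity and inequality in `C^∞(K)` may be checked on a residual subset of `K`: by Baire's
theorem such a set is dense, and the functions are continuous. Generically, that is on a residual
set, all operations are pointwise operations on real numbers, and so is the supremum of a sequence,
because `K` is extremally disconnected (`CInf.exists_continuous_eventually_isLUB`). Two facts give
the theorem.

* Generically `f(X) = f ∘ X`. The band component of `e` at `(X - t e)⁺` is the supremum of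
  `n (X - t e)⁺ ∧ e`, so `A_t` is generically the indicator of `{X ≤ t}`. A step function involves
  finitely many `t` and an increasing sequence of step functions countably many, so `I(g) = g ∘ X`
  generically for every increasing limit `g` of step functions
  (`MaedaOgasawaraRep.eventually_val_of_hasDaniellIntegral`). This determines `f(X)`. It exists for
  continuous `f` because a nonnegative continuous function is a countable supremum of step functions
  (`exists_monotone_isStepOn`), and its composition with `X` is continuous where `X` is finite.

* For sequences, unbounded order convergence is generic pointwise convergence
  (`MaedaOgasawaraRep.eventually_tendsto_ev`, `CInf.uoTendsto_of_eventually_tendsto_val`). In one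
  direction it suffices to truncate by `e`, and infima pass from `E` to `C^∞(K)` by order density;
  in the other the tails `sup_{m ≥ n} |y_m - y| ∧ u` dominate and decrease to `0`.

Continuity of `f` preserves pointwise convergence.
-/

/-! ### Generic evaluation of elements of `C^∞(K)` -/

namespace CInf

section Val

variable {K : Type*} [TopologicalSpace K]

/-- The real value of `f` at `ω`. At the points of the nowhere dense set where `f` is infinite it
is the junk value `0`, so statements about `val` are made on residual sets. -/
noncomputable def val (f : CInf K) (ω : K) : ℝ := (f ω).toReal

theorem eventually_coe_val (f : CInf K) : ∀ᶠ ω in residual K, f ω = (f.val ω : EReal) := by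
  filter_upwards [fin_ae f] with ω ⟨r, hr⟩
  rw [val, hr, EReal.toReal_coe]

theorem val_zero (ω : K) : (0 : CInf K).val ω = 0 := rfl

theorem val_one (ω : K) : (1 : CInf K).val ω = 1 := rfl

theorem eventually_val_sup (f g : CInf K) :
    ∀ᶠ ω in residual K, (f ⊔ g).val ω = f.val ω ⊔ g.val ω := by
  filter_upwards [fin_ae f, fin_ae g] with ω ⟨r, hr⟩ ⟨s, hs⟩
  rw [val, val, val, sup_apply, hr, hs, ← EReal.coe_strictMono.monotone.map_sup]
  simp only [EReal.toReal_coe]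

theorem eventually_val_inf (f g : CInf K) :
    ∀ᶠ ω in residual K, (f ⊓ g).val ω = f.val ω ⊓ g.val ω := by
  filter_upwards [fin_ae f, fin_ae g] with ω ⟨r, hr⟩ ⟨s, hs⟩
  rw [val, val, val, inf_apply, hr, hs, ← EReal.coe_strictMono.monotone.map_inf]
  simp only [EReal.toReal_coe]

theorem eventually_val_le {f g : CInf K} (h : f ≤ g) :
    ∀ᶠ ω in residual K, f.val ω ≤ g.val ω := by
  filter_upwards [eventually_coe_val f, eventually_coe_val g] with ω h1 h2
  have := le_def.1 h ω
  rwa [h1, h2, EReal.coe_le_coe_iff] at this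

theorem le_of_eventually_val_le [BaireSpace K] {f g : CInf K}
    (h : ∀ᶠ ω in residual K, f.val ω ≤ g.val ω) : f ≤ g := le_of_ae <| by
  filter_upwards [eventually_coe_val f, eventually_coe_val g, h] with ω h1 h2 h3
  rwa [h1, h2, EReal.coe_le_coe_iff]

theorem eq_of_eventually_val_eq [BaireSpace K] {f g : CInf K}
    (h : ∀ᶠ ω in residual K, f.val ω = g.val ω) : f = g :=
  le_antisymm (le_of_eventually_val_le (h.mono fun _ h => h.le))
    (le_of_eventually_val_le (h.mono fun _ h => h.ge))

theorem le_of_eventually_le [BaireSpace K] {u v : C(K, EReal)}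
    (h : ∀ᶠ ω in residual K, u ω ≤ v ω) (ω : K) : u ω ≤ v ω := by
  have hc : IsClosed {ω | u ω ≤ v ω} := isClosed_le u.continuous v.continuous
  exact hc.closure_subset_iff.2 subset_rfl (dense_of_mem_residual h ω)

/-! ### Suprema of sequences of continuous functions are generically pointwise -/

/-- In an extremally disconnected space the closures of the open sets `{ω | q < sup_n d_n ω}`,
`q ∈ ℚ`, are open. They are therefore the superlevel sets of a continuous function, which agrees
with the pointwise supremum off the countably many nowhere dense boundaries. -/
theorem exists_continuous_eventually_isLUB [ExtremallyDisconnected K]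
    (d : ℕ → C(K, EReal)) :
    ∃ w : C(K, EReal), ∀ᶠ ω in residual K, IsLUB (range fun n => d n ω) (w ω) := by
  let U : ℚ → Set K := fun q => ⋃ n, {ω | ((q : ℝ) : EReal) < d n ω}
  have hU : ∀ q, IsOpen (U q) := fun q =>
    isOpen_iUnion fun n => isOpen_lt continuous_const (d n).continuous
  have hanti : ∀ {q r : ℚ}, q ≤ r → closure (U r) ⊆ closure (U q) := fun {q r} hqr =>
    closure_mono <| iUnion_mono fun n ω hω =>
      lt_of_le_of_lt (EReal.coe_le_coe_iff.2 (Rat.cast_le.2 hqr)) hω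
  let w : K → EReal := fun ω => ⨆ (q : ℚ) (_ : ω ∈ closure (U q)), ((q : ℝ) : EReal)
  have hlt : ∀ a ω, a < w ω ↔ ∃ q : ℚ, ω ∈ closure (U q) ∧ a < ((q : ℝ) : EReal) := by
    intro a ω
    simp only [w, lt_iSup_iff, exists_prop]
  have hgt : ∀ a ω, w ω < a ↔ ∃ q : ℚ, ω ∉ closure (U q) ∧ ((q : ℝ) : EReal) < a := by
    intro a ω
    constructor
    · intro h
      obtain ⟨q, h1, h2⟩ := EReal.lt_iff_exists_rat_btwn.1 h
      refine ⟨q, fun hq => h1.not_ge ?_, h2⟩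
      exact le_iSup₂ (f := fun (q : ℚ) (_ : ω ∈ closure (U q)) => ((q : ℝ) : EReal)) q hq
    · rintro ⟨q, h1, h2⟩
      refine lt_of_le_of_lt (iSup₂_le fun r hr => ?_) h2
      have : r ≤ q := by
        by_contra! hqr
        exact h1 (hanti hqr.le hr)
      exact EReal.coe_le_coe_iff.2 (Rat.cast_le.2 this)
  have hw : Continuous w := by
    refine OrderTopology.continuous_iff.2 fun a => ⟨?_, ?_⟩
    · have : w ⁻¹' Ioi a = ⋃ (q : ℚ) (_ : a < ((q : ℝ) : EReal)), closure (U q) := by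
        ext ω
        simp only [mem_preimage, mem_Ioi, hlt, mem_iUnion, exists_prop, and_comm]
      rw [this]
      exact isOpen_biUnion fun q _ => ExtremallyDisconnected.open_closure _ (hU q)
    · have : w ⁻¹' Iio a = ⋃ (q : ℚ) (_ : ((q : ℝ) : EReal) < a), (closure (U q))ᶜ := by
        ext ω
        simp only [mem_preimage, mem_Iio, hgt, mem_iUnion, exists_prop, and_comm, mem_compl_iff]
      rw [this]
      exact isOpen_biUnion fun q _ => isClosed_closure.isOpen_compl
  refine ⟨⟨w, hw⟩, ?_⟩
  -- Off the boundaries of the sets `U q` passing to the closures changes nothing.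
  have hres : ∀ᶠ ω in residual K, ∀ q, ω ∈ closure (U q) → ω ∈ U q := by
    refine eventually_countable_forall.2 fun q => ?_
    have hd : Dense (frontier (U q))ᶜ := by
      rw [← interior_eq_empty_iff_dense_compl, ← frontier_compl]
      exact interior_frontier (hU q).isClosed_compl
    filter_upwards [residual_of_dense_open isClosed_frontier.isOpen_compl hd] with ω hω hc
    by_contra hn
    exact hω ((hU q).frontier_eq ▸ ⟨hc, hn⟩)
  filter_upwards [hres] with ω hω
  constructor
  · rintro _ ⟨n, rfl⟩
    refine le_of_forall_lt fun c hc => (hlt c ω).2 ?_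
    obtain ⟨q, h1, h2⟩ := EReal.lt_iff_exists_rat_btwn.1 hc
    exact ⟨q, subset_closure (mem_iUnion.2 ⟨n, h2⟩), h1⟩
  · intro b hb
    refine iSup₂_le fun q hq => ?_
    obtain ⟨n, hn⟩ := mem_iUnion.1 (hω q hq)
    exact (le_of_lt hn).trans (hb ⟨n, rfl⟩)

end Val

variable {K : Type*} [TopologicalSpace K] [CompactSpace K] [T2Space K] [ExtremallyDisconnected K]

/-! ### Generic evaluation of the linear operations -/

theorem eventually_val_add (f g : CInf K) :
    ∀ᶠ ω in residual K, (f + g).val ω = f.val ω + g.val ω := by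
  filter_upwards [add_ae f g] with ω h
  rw [val, h, EReal.toReal_coe]; rfl

theorem eventually_val_smul (c : ℝ) (f : CInf K) :
    ∀ᶠ ω in residual K, (c • f).val ω = c * f.val ω := by
  filter_upwards [smul_ae c f] with ω h
  rw [val, h, EReal.toReal_coe]; rfl

theorem eventually_val_neg (f : CInf K) :
    ∀ᶠ ω in residual K, (-f).val ω = -f.val ω := by
  filter_upwards [neg_ae f] with ω h
  rw [val, h, EReal.toReal_coe]; rfl

theorem eventually_val_sub (f g : CInf K) :
    ∀ᶠ ω in residual K, (f - g).val ω = f.val ω - g.val ω := by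
  rw [sub_eq_add_neg]
  filter_upwards [eventually_val_add f (-g), eventually_val_neg g] with ω h1 h2
  rw [h1, h2, sub_eq_add_neg]

theorem eventually_val_abs (f : CInf K) :
    ∀ᶠ ω in residual K, |f|.val ω = |f.val ω| := by
  filter_upwards [eventually_val_sup f (-f), eventually_val_neg f] with ω h1 h2
  rw [abs, h1, h2]; rfl

theorem eventually_val_sum {ι : Type*} (s : Finset ι) (f : ι → CInf K) :
    ∀ᶠ ω in residual K, (∑ i ∈ s, f i).val ω = ∑ i ∈ s, (f i).val ω := by
  classical
  induction s using Finset.induction_on with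
  | empty => exact Eventually.of_forall fun ω => by simp [val_zero]
  | insert a s ha ih =>
    rw [Finset.sum_insert ha]
    filter_upwards [ih, eventually_val_add (f a) (∑ i ∈ s, f i)] with ω h1 h2
    rw [h2, h1, Finset.sum_insert ha]

/-! ### Bounded suprema and infima of sequences in `C^∞(K)` -/

theorem exists_eventually_isLUB_val {d : ℕ → CInf K} {u : CInf K} (hu : ∀ n, d n ≤ u) :
    ∃ z : CInf K, ∀ᶠ ω in residual K, IsLUB (range fun n => (d n).val ω) (z.val ω) := by
  obtain ⟨w, hw⟩ := exists_continuous_eventually_isLUB fun n => (d n).1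
  have hdw : ∀ ω, d 0 ω ≤ w ω := le_of_eventually_le (u := (d 0).1) <| by
    filter_upwards [hw] with ω h using h.1 ⟨0, rfl⟩
  have hwu : ∀ ω, w ω ≤ u ω := le_of_eventually_le (v := u.1) <| by
    filter_upwards [hw] with ω h
    refine h.2 ?_
    rintro _ ⟨n, rfl⟩
    exact le_def.1 (hu n) ω
  have hfin : IsNowhereDense {ω | w ω = ⊥ ∨ w ω = ⊤} := by
    refine isNowhereDense_of_finite_on ((d 0).isOpen_fin.inter u.isOpen_fin)
      ((d 0).dense_fin.inter_of_isOpen_left u.dense_fin (d 0).isOpen_fin) ?_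
    rintro ω ⟨h1, h2⟩
    simp only [fin, mem_compl_iff, mem_ofPred_eq, not_or] at h1 h2
    refine ⟨fun h => h1.1 ?_, fun h => h2.2 ?_⟩
    · exact le_bot_iff.1 (h ▸ hdw ω)
    · exact top_le_iff.1 (h ▸ hwu ω)
  refine ⟨⟨w, hfin⟩, ?_⟩
  filter_upwards [hw, eventually_coe_val ⟨w, hfin⟩,
    eventually_countable_forall.2 fun n => eventually_coe_val (d n)] with ω h1 h2 h3
  change w ω = _ at h2
  rw [h2] at h1
  constructor
  · rintro _ ⟨n, rfl⟩
    have := h1.1 ⟨n, rfl⟩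
    change d n ω ≤ _ at this
    rwa [h3, EReal.coe_le_coe_iff] at this
  · intro b hb
    rw [← EReal.coe_le_coe_iff]
    refine h1.2 ?_
    rintro _ ⟨n, rfl⟩
    change d n ω ≤ _
    rw [h3, EReal.coe_le_coe_iff]
    exact hb ⟨n, rfl⟩

theorem exists_eventually_isGLB_val {d : ℕ → CInf K} {u : CInf K} (hu : ∀ n, u ≤ d n) :
    ∃ z : CInf K, ∀ᶠ ω in residual K, IsGLB (range fun n => (d n).val ω) (z.val ω) := by
  obtain ⟨z, hz⟩ := exists_eventually_isLUB_val (d := fun n => -d n) fun n => neg_le_neg (hu n)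
  refine ⟨-z, ?_⟩
  filter_upwards [hz, eventually_val_neg z,
    eventually_countable_forall.2 fun n => eventually_val_neg (d n)] with ω h1 h2 h3
  simp only [h3] at h1
  rw [h2, ← isLUB_neg]
  rw [← Set.image_neg_eq_neg, ← range_comp]
  exact h1

/-! ### Unbounded order convergence is implied by generic pointwise convergence -/

/-- The dominating sequence is `z_n = sup_{m ≥ n} |y_m - y| ∧ u`. -/
theorem uoTendsto_of_eventually_tendsto_val {y : ℕ → CInf K} {y₀ : CInf K}
    (h : ∀ᶠ ω in residual K, Tendsto (fun n => (y n).val ω) atTop (𝓝 (y₀.val ω))) :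
    UOTendsto y y₀ := by
  intro u hu
  have hz : ∀ n, ∃ z : CInf K, ∀ᶠ ω in residual K,
      IsLUB (range fun k => (|y (n + k) - y₀| ⊓ u).val ω) (z.val ω) := fun n =>
    exists_eventually_isLUB_val (u := u) fun k => inf_le_right
  choose z hz using hz
  have hz' := eventually_countable_forall.2 hz
  have hd : ∀ᶠ ω in residual K, ∀ n,
      (|y n - y₀| ⊓ u).val ω = |(y n).val ω - y₀.val ω| ⊓ u.val ω := by
    refine eventually_countable_forall.2 fun n => ?_
    filter_upwards [eventually_val_inf |y n - y₀| u, eventually_val_abs (y n - y₀),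
      eventually_val_sub (y n) y₀] with ω h1 h2 h3
    rw [h1, h2, h3]
  have hle : ∀ n k, |y (n + k) - y₀| ⊓ u ≤ z n := fun n k => le_of_eventually_val_le <| by
    filter_upwards [hz n] with ω h using h.1 ⟨k, rfl⟩
  have hnn : ∀ n, 0 ≤ |y n - y₀| ⊓ u := fun n => le_of_eventually_val_le <| by
    filter_upwards [hd, eventually_val_le hu] with ω h1 h2
    rw [h1, val_zero]
    exact le_inf (abs_nonneg _) h2
  refine ⟨z, ?_, ⟨?_, ?_⟩, fun n => ?_⟩
  · intro m n hmn
    refine le_of_eventually_val_le ?_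
    filter_upwards [hz'] with ω h
    refine (h n).2 ?_
    rintro _ ⟨k, rfl⟩
    refine (h m).1 ⟨n - m + k, ?_⟩
    simp only [show m + (n - m + k) = n + k by lia]
  · rintro _ ⟨n, rfl⟩
    exact (hnn n).trans (hle n 0)
  · intro g hg
    refine le_of_eventually_val_le ?_
    filter_upwards [h, hz', hd, eventually_val_le hu,
      eventually_countable_forall.2 fun n => eventually_val_le (hg ⟨n, rfl⟩)] with ω h1 h2 h3 h4 h5
    rw [val_zero] at h4 ⊢
    refine le_of_forall_pos_le_add fun ε hε => ?_
    obtain ⟨N, hN⟩ := Metric.tendsto_atTop.1 h1 ε hε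
    refine (h5 N).trans ((h2 N).2 ?_)
    rintro _ ⟨k, rfl⟩
    change (|y (N + k) - y₀| ⊓ u).val ω ≤ _
    rw [h3, zero_add]
    have := hN (N + k) (by lia)
    rw [Real.dist_eq] at this
    exact inf_le_left.trans this.le
  · have h0 : |(|y n - y₀| ⊓ u) - 0| = |y n - y₀| ⊓ u := by
      rw [sub_zero]; exact abs_of_nonneg (hnn n)
    simp only
    rw [h0]
    exact hle n 0

end CInf

namespace MaedaOgasawaraRep

variable {E : Type*} [ConditionallyCompleteLattice E] [AddCommGroup E] [Module ℝ E]
  {K : Type*} [TopologicalSpace K] [CompactSpace K] [T2Space K] [ExtremallyDisconnected K]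
  {e : E} (R : MaedaOgasawaraRep e K)

/-! ### Generic evaluation of elements of a represented vector lattice -/

/-- The real value at `ω` of the function that represents `x`; as for `CInf.val`, only the values
on a residual set are meaningful. -/
noncomputable def ev (x : E) (ω : K) : ℝ := (R.toLin x).val ω

theorem le_iff (x y : E) : x ≤ y ↔ R.toLin x ≤ R.toLin y := by
  rw [← sup_eq_right, ← sup_eq_right, ← R.map_sup, R.injective.eq_iff]

theorem eventually_ev_le {x y : E} (h : x ≤ y) : ∀ᶠ ω in residual K, R.ev x ω ≤ R.ev y ω :=
  CInf.eventually_val_le ((R.le_iff x y).1 h)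

theorem le_of_eventually_ev_le {x y : E} (h : ∀ᶠ ω in residual K, R.ev x ω ≤ R.ev y ω) : x ≤ y :=
  (R.le_iff x y).2 (CInf.le_of_eventually_val_le h)

theorem eq_of_eventually_ev_eq {x y : E} (h : ∀ᶠ ω in residual K, R.ev x ω = R.ev y ω) : x = y :=
  R.injective (CInf.eq_of_eventually_val_eq h)

theorem ev_zero (ω : K) : R.ev 0 ω = 0 := by rw [ev, map_zero, CInf.val_zero]

theorem ev_unit (ω : K) : R.ev e ω = 1 := by rw [ev, R.map_unit, CInf.val_one]

theorem eventually_ev_add (x y : E) :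
    ∀ᶠ ω in residual K, R.ev (x + y) ω = R.ev x ω + R.ev y ω := by
  simp only [ev, map_add]; exact CInf.eventually_val_add _ _

theorem eventually_ev_sub (x y : E) :
    ∀ᶠ ω in residual K, R.ev (x - y) ω = R.ev x ω - R.ev y ω := by
  simp only [ev, map_sub]; exact CInf.eventually_val_sub _ _

theorem eventually_ev_smul (c : ℝ) (x : E) :
    ∀ᶠ ω in residual K, R.ev (c • x) ω = c * R.ev x ω := by
  simp only [ev, map_smul]; exact CInf.eventually_val_smul _ _

theorem eventually_ev_sup (x y : E) :
    ∀ᶠ ω in residual K, R.ev (x ⊔ y) ω = R.ev x ω ⊔ R.ev y ω := by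
  simp only [ev, R.map_sup]; exact CInf.eventually_val_sup _ _

theorem eventually_ev_abs (x : E) : ∀ᶠ ω in residual K, R.ev |x| ω = |R.ev x ω| := by
  simp only [ev, abs, R.map_sup, map_neg]; exact CInf.eventually_val_abs _

theorem eventually_ev_sum {ι : Type*} (s : Finset ι) (x : ι → E) :
    ∀ᶠ ω in residual K, R.ev (∑ i ∈ s, x i) ω = ∑ i ∈ s, R.ev (x i) ω := by
  simp only [ev, map_sum]; exact CInf.eventually_val_sum _ _

/-- The elements that vanish generically on `{0 < q}`. -/
def vanishing (q : E) : Submodule ℝ E where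
  carrier := {x | ∀ᶠ ω in residual K, 0 < R.ev q ω → R.ev x ω = 0}
  add_mem' {x y} hx hy := by
    filter_upwards [hx, hy, R.eventually_ev_add x y] with ω h1 h2 h3 hω
    rw [h3, h1 hω, h2 hω, add_zero]
  zero_mem' := by
    change ∀ᶠ ω in residual K, 0 < R.ev q ω → R.ev 0 ω = 0
    exact Eventually.of_forall fun ω _ => R.ev_zero ω
  smul_mem' c x hx := by
    filter_upwards [hx, R.eventually_ev_smul c x] with ω h1 h2 hω
    rw [h2, h1 hω, mul_zero]

theorem mem_vanishing {q x : E} :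
    x ∈ R.vanishing q ↔ ∀ᶠ ω in residual K, 0 < R.ev q ω → R.ev x ω = 0 := Iff.rfl

section Ordered

variable [IsOrderedAddMonoid E]

theorem eventually_ev_inf (x y : E) :
    ∀ᶠ ω in residual K, R.ev (x ⊓ y) ω = R.ev x ω ⊓ R.ev y ω := by
  have h : x ⊓ y = x + y - (x ⊔ y) := eq_sub_of_add_eq (inf_add_sup x y)
  rw [h]
  filter_upwards [R.eventually_ev_sub (x + y) (x ⊔ y), R.eventually_ev_add x y,
    R.eventually_ev_sup x y] with ω h1 h2 h3
  rw [h1, h2, h3]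
  exact (eq_sub_of_add_eq (inf_add_sup _ _)).symm

/-! ### The spectral system is generically the system of indicators of the sets `{X ≤ t}` -/

theorem isBand_vanishing {q : E} (hq : 0 ≤ q) : IsBand (R.vanishing q) := by
  have hq' := R.eventually_ev_le hq
  refine ⟨fun x y hxy hy => ?_, fun S s hS hs => ?_⟩
  · rw [mem_vanishing] at hy ⊢
    filter_upwards [hy, R.eventually_ev_le hxy, R.eventually_ev_abs x,
      R.eventually_ev_abs y] with ω h1 h2 h3 h4 hω
    rw [h3, h4, h1 hω, abs_zero] at h2
    exact abs_eq_zero.1 (le_antisymm h2 (abs_nonneg _))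
  · rw [mem_vanishing]
    -- Subtracting `s⁺ ∧ q` lowers the value of `s` where `0 < q` and `0 < s`, and leaves an upper
    -- bound of `S`.
    have hlow : ∀ᶠ ω in residual K, 0 < R.ev q ω → 0 ≤ R.ev s ω := by
      -- The supremum of the empty set is a least element, hence `0` in a group.
      rcases S.eq_empty_or_nonempty with rfl | ⟨x, hx⟩
      · have : s ≤ s + s := hs.2 (by simp)
        have : 0 ≤ s := by simpa using this
        filter_upwards [R.eventually_ev_le this] with ω h1 _
        rwa [R.ev_zero] at h1
      · filter_upwards [R.eventually_ev_le (hs.1 hx), R.mem_vanishing.1 (hS hx)] with ω h1 h2 hω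
        rwa [h2 hω] at h1
    have hle : s ≤ s - (s ⊔ 0) ⊓ q := by
      refine hs.2 fun x hx => R.le_of_eventually_ev_le ?_
      filter_upwards [R.eventually_ev_sub s ((s ⊔ 0) ⊓ q), R.eventually_ev_inf (s ⊔ 0) q,
        R.eventually_ev_sup s 0, hlow, R.mem_vanishing.1 (hS hx), R.eventually_ev_le (hs.1 hx), hq']
        with ω h1 h2 h3 h4 h5 h6 h7
      rw [R.ev_zero] at h7
      rw [h1, h2, h3, R.ev_zero]
      rcases h7.eq_or_lt with h | h
      · rw [← h, inf_eq_right.2 le_sup_right, sub_zero]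
        exact h6
      · rw [h5 h, sup_eq_left.2 (h4 h)]
        exact sub_nonneg.2 inf_le_left
    filter_upwards [R.eventually_ev_le hle, R.eventually_ev_sub s ((s ⊔ 0) ⊓ q),
      R.eventually_ev_inf (s ⊔ 0) q, R.eventually_ev_sup s 0, hlow] with ω h1 h2 h3 h4 h5 hω
    rw [h2, h3, h4, R.ev_zero] at h1
    have h6 : (R.ev s ω ⊔ 0) ⊓ R.ev q ω ≤ 0 := by linarith
    rcases inf_le_iff.1 h6 with h | h
    · exact le_antisymm (le_sup_left.trans h) (h5 hω)
    · exact absurd h hω.not_ge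

theorem bandComponent_unique (R : MaedaOgasawaraRep e K) {y p p' : E} (hp : IsBandComponent y e p)
    (hp' : IsBandComponent y e p') : p = p' := by
  have h : p - p' ∈ bandGen y := Submodule.sub_mem _ hp.1 hp'.1
  refine R.eq_of_eventually_ev_eq ?_
  filter_upwards [R.eventually_ev_inf |e - p| |p - p'|, R.eventually_ev_inf |e - p'| |p - p'|,
    R.eventually_ev_abs (e - p), R.eventually_ev_abs (e - p'), R.eventually_ev_abs (p - p'),
    R.eventually_ev_sub e p, R.eventually_ev_sub e p', R.eventually_ev_sub p p']
    with ω h1 h2 h3 h4 h5 h6 h7 h8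
  rw [hp.2 _ h, R.ev_zero, h3, h5, h6, h8] at h1
  rw [hp'.2 _ h, R.ev_zero, h4, h5, h7, h8] at h2
  by_contra hne
  have h9 : |R.ev p ω - R.ev p' ω| ≠ 0 := abs_ne_zero.2 (sub_ne_zero.2 hne)
  have key : ∀ a : ℝ, 0 = |a| ⊓ |R.ev p ω - R.ev p' ω| → a = 0 := by
    intro a ha
    rcases min_choice |a| |R.ev p ω - R.ev p' ω| with h | h
    · exact abs_eq_zero.1 (h.symm.trans ha.symm)
    · exact absurd (h.symm.trans ha.symm) h9
  have := key _ h1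
  have := key _ h2
  exact hne (by linarith)

/-- The component of `e` in the band generated by `y ≥ 0` is `sup_n (n y ∧ e)`, which is
generically the indicator of `{0 < y}`. -/
theorem eventually_ev_bandProj {y : E} (hy : 0 ≤ y) :
    ∀ᶠ ω in residual K, R.ev (bandProj y e) ω = if 0 < R.ev y ω then 1 else 0 := by
  let d : ℕ → E := fun n => ((n : ℝ) • y) ⊓ e
  have hd : ∀ᶠ ω in residual K, ∀ n, R.ev (d n) ω = ((n : ℝ) * R.ev y ω) ⊓ 1 := by
    refine eventually_countable_forall.2 fun n => ?_
    filter_upwards [R.eventually_ev_inf ((n : ℝ) • y) e, R.eventually_ev_smul (n : ℝ) y]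
      with ω h1 h2
    rw [h1, h2, R.ev_unit]
  have hlub : ∀ r : ℝ, 0 ≤ r →
      IsLUB (range fun n : ℕ => ((n : ℝ) * r) ⊓ 1) (if 0 < r then 1 else 0) := by
    intro r hr
    refine ⟨?_, fun b hb => ?_⟩
    · rintro _ ⟨n, rfl⟩
      simp only
      split_ifs with h
      · exact inf_le_right
      · rw [le_antisymm (not_lt.1 h) hr, mul_zero]
        exact inf_le_left
    · split_ifs with h
      · obtain ⟨n, hn⟩ := Archimedean.arch 1 h
        have := hb ⟨n, rfl⟩
        rw [nsmul_eq_mul] at hn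
        simpa only [inf_eq_right.2 hn] using this
      · simpa using hb ⟨0, rfl⟩
  have hy' := R.eventually_ev_le hy
  obtain ⟨z, hz⟩ := CInf.exists_eventually_isLUB_val (d := fun n => R.toLin (d n))
    (u := R.toLin e) fun n => (R.le_iff _ _).1 inf_le_right
  have hz' : ∀ᶠ ω in residual K, z.val ω = if 0 < R.ev y ω then 1 else 0 := by
    filter_upwards [hz, hd, hy'] with ω h1 h2 h3
    rw [R.ev_zero] at h3
    change IsLUB (range fun n => R.ev (d n) ω) _ at h1
    simp only [h2] at h1
    exact h1.unique (hlub _ h3)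
  obtain ⟨p, hpz⟩ : ∃ p, R.toLin p = z := by
    refine R.ideal z e (CInf.le_of_eventually_val_le ?_)
    filter_upwards [hz', CInf.eventually_val_abs z, R.eventually_ev_abs e,
      CInf.eventually_val_abs (R.toLin e)] with ω h1 h2 h3 h4
    change _ = |R.ev e ω| at h4
    rw [h2, h4, h1, R.ev_unit]
    split_ifs <;> norm_num
  have hpv : ∀ᶠ ω in residual K, R.ev p ω = if 0 < R.ev y ω then 1 else 0 := by
    simpa only [ev, hpz] using hz'
  have hplub : IsLUB (range d) p := by
    refine ⟨?_, fun b hb => R.le_of_eventually_ev_le ?_⟩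
    · rintro _ ⟨n, rfl⟩
      refine R.le_of_eventually_ev_le ?_
      filter_upwards [hd, hpv, hy'] with ω h1 h2 h3
      rw [R.ev_zero] at h3
      rw [h1, h2]
      exact (hlub _ h3).1 ⟨n, rfl⟩
    · filter_upwards [hd, hpv, hy', eventually_countable_forall.2 fun n =>
        R.eventually_ev_le (hb ⟨n, rfl⟩)] with ω h1 h2 h3 h4
      rw [R.ev_zero] at h3
      rw [h2]
      refine (hlub _ h3).2 ?_
      rintro _ ⟨n, rfl⟩
      simp only [← h1]
      exact h4 n
  have hcomp : IsBandComponent y e p := by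
    refine ⟨?_, fun b hb => ?_⟩
    · rw [bandGen, Submodule.mem_sInf]
      rintro B ⟨hB, hyB⟩
      refine hB.isLUB_mem _ p ?_ hplub
      rintro _ ⟨n, rfl⟩
      refine hB.solid _ ((n : ℝ) • y) (R.le_of_eventually_ev_le ?_) (B.smul_mem _ hyB)
      filter_upwards [R.eventually_ev_abs (d n), R.eventually_ev_abs ((n : ℝ) • y), hd,
        R.eventually_ev_smul (n : ℝ) y, hy'] with ω h1 h2 h3 h4 h5
      rw [R.ev_zero] at h5
      have h6 : 0 ≤ (n : ℝ) * R.ev y ω := by positivity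
      rw [h1, h2, h3, h4, abs_of_nonneg h6, abs_of_nonneg (le_inf h6 zero_le_one)]
      exact inf_le_left
    · -- The elements that vanish where `e - p` is positive form a band that contains `y`.
      have hq : ∀ᶠ ω in residual K, R.ev (e - p) ω = if 0 < R.ev y ω then 0 else 1 := by
        filter_upwards [hpv, R.eventually_ev_sub e p] with ω h1 h2
        rw [h2, h1, R.ev_unit]
        split_ifs <;> norm_num
      have hband : IsBand (R.vanishing (e - p)) := by
        refine R.isBand_vanishing (R.le_of_eventually_ev_le ?_)
        filter_upwards [hq] with ω h1
        rw [h1, R.ev_zero]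
        split_ifs <;> norm_num
      have hyv : y ∈ R.vanishing (e - p) := by
        rw [mem_vanishing]
        filter_upwards [hq, hy'] with ω h1 h2 h3
        rw [R.ev_zero] at h2
        by_contra hne
        rw [h1, if_pos (lt_of_le_of_ne h2 (Ne.symm hne))] at h3
        exact lt_irrefl _ h3
      have hbv : b ∈ R.vanishing (e - p) := (Submodule.mem_sInf.1 hb) _ ⟨hband, hyv⟩
      rw [mem_vanishing] at hbv
      refine R.eq_of_eventually_ev_eq ?_
      filter_upwards [hq, hbv, R.eventually_ev_inf |e - p| |b|, R.eventually_ev_abs (e - p),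
        R.eventually_ev_abs b] with ω h1 h2 h3 h4 h5
      rw [h3, h4, h5, R.ev_zero]
      by_cases h : 0 < R.ev y ω
      · rw [h1, if_pos h, abs_zero]
        exact inf_eq_left.2 (abs_nonneg _)
      · rw [h2 (by rw [h1, if_neg h]; norm_num), abs_zero]
        exact inf_eq_right.2 (abs_nonneg _)
  have hex : ∃ p, IsBandComponent y e p := ⟨p, hcomp⟩
  have : bandProj y e = p := by
    rw [bandProj, dif_pos hex]
    exact R.bandComponent_unique hex.choose_spec hcomp
  rwa [this]

theorem eventually_ev_spectralSystem (X : E) (t : ℝ) :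
    ∀ᶠ ω in residual K, R.ev (spectralSystem e X t) ω = if R.ev X ω ≤ t then 1 else 0 := by
  have hpos : (0 : E) ≤ (X - t • e)⁺ := posPart_nonneg _
  filter_upwards [R.eventually_ev_sub e (bandProj (X - t • e)⁺ e), R.eventually_ev_bandProj hpos,
    R.eventually_ev_sup (X - t • e) 0, R.eventually_ev_sub X (t • e),
    R.eventually_ev_smul t e] with ω h1 h2 h3 h4 h5
  rw [spectralSystem, h1, h2, posPart_def, h3, h4, h5, R.ev_unit, R.ev_zero]
  by_cases h : R.ev X ω ≤ t
  · rw [if_pos h, if_neg (by simp [h]), sub_zero]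
  · rw [if_neg h, if_pos (by simpa using h), sub_self]

theorem eventually_ev_spectralSystemExt (X : E) (s : EReal) :
    ∀ᶠ ω in residual K,
      R.ev (spectralSystemExt e X s) ω = if (R.ev X ω : EReal) ≤ s then 1 else 0 := by
  have hb : ∀ t, 0 ≤ spectralSystem e X t ∧ spectralSystem e X t ≤ e := fun t => by
    constructor <;> refine R.le_of_eventually_ev_le ?_ <;>
    filter_upwards [R.eventually_ev_spectralSystem X t] with ω h1 <;>
    rw [h1] <;> simp only [R.ev_zero, R.ev_unit] <;> split_ifs <;> norm_num
  induction s with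
  | bot =>
    have hA : spectralSystemExt e X ⊥ = 0 := by
      rw [spectralSystemExt, if_pos rfl]
      have hbdd : BddBelow (range (spectralSystem e X)) :=
        ⟨0, by rintro _ ⟨t, rfl⟩; exact (hb t).1⟩
      refine le_antisymm (R.le_of_eventually_ev_le ?_) (le_ciInf fun t => (hb t).1)
      filter_upwards [eventually_countable_forall.2 fun n : ℕ =>
          R.eventually_ev_le (ciInf_le hbdd (-(n : ℝ))),
        eventually_countable_forall.2 fun n : ℕ => R.eventually_ev_spectralSystem X (-(n : ℝ))]
        with ω h1 h2
      obtain ⟨n, hn⟩ := exists_nat_gt (-R.ev X ω)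
      have := h1 n
      rwa [h2, if_neg (by linarith), ← R.ev_zero ω] at this
    refine Eventually.of_forall fun ω => ?_
    rw [hA, R.ev_zero, if_neg (by simp)]
  | top =>
    have hA : spectralSystemExt e X ⊤ = e := by
      rw [spectralSystemExt, if_neg (by simp), if_pos rfl]
      have hbdd : BddAbove (range (spectralSystem e X)) :=
        ⟨e, by rintro _ ⟨t, rfl⟩; exact (hb t).2⟩
      refine le_antisymm (ciSup_le fun t => (hb t).2) (R.le_of_eventually_ev_le ?_)
      filter_upwards [eventually_countable_forall.2 fun n : ℕ =>
          R.eventually_ev_le (le_ciSup hbdd (n : ℝ)),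
        eventually_countable_forall.2 fun n : ℕ => R.eventually_ev_spectralSystem X (n : ℝ)]
        with ω h1 h2
      obtain ⟨n, hn⟩ := exists_nat_ge (R.ev X ω)
      have := h1 n
      rwa [h2, if_pos hn, ← R.ev_unit ω] at this
    refine Eventually.of_forall fun ω => ?_
    rw [hA, R.ev_unit, if_pos le_top]
  | coe t =>
    rw [spectralSystemExt, if_neg (EReal.coe_ne_bot t), if_neg (EReal.coe_ne_top t),
      EReal.toReal_coe]
    simpa only [EReal.coe_le_coe_iff] using R.eventually_ev_spectralSystem X t

/-! ### The Daniell integral of `f` is generically `f ∘ X` -/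

/-- Adjoining `A_{-∞} = 0` and `A_∞ = e`, a difference `A_b - A_a` is generically the indicator of
`{a < X ≤ b}`. -/
theorem eventually_ev_of_hasSpectralMeasure {X : E} {S : Set ℝ} {m : E}
    (h : HasSpectralMeasure e X S m) :
    ∀ᶠ ω in residual K, R.ev m ω = S.indicator (fun _ => 1) (R.ev X ω) := by
  obtain ⟨n, a, b, hab, hdisj, rfl, rfl⟩ := h
  filter_upwards [R.eventually_ev_sum Finset.univ fun i =>
      spectralSystemExt e X (b i) - spectralSystemExt e X (a i),
    eventually_countable_forall.2 fun i => R.eventually_ev_sub (spectralSystemExt e X (b i))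
      (spectralSystemExt e X (a i)),
    eventually_countable_forall.2 fun i => R.eventually_ev_spectralSystemExt X (a i),
    eventually_countable_forall.2 fun i => R.eventually_ev_spectralSystemExt X (b i)]
    with ω h1 h2 h3 h4
  have hU : (⋃ i, halfOpen (a i) (b i)) = ⋃ i ∈ (Finset.univ : Finset (Fin n)),
      halfOpen (a i) (b i) := by simp
  rw [h1, hU, Finset.indicator_biUnion _ _ fun i _ j _ hij => hdisj hij]
  refine Finset.sum_congr rfl fun i _ => ?_
  rw [h2, h3, h4]
  rcases le_or_gt (R.ev X ω : EReal) (a i) with h | h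
  · rw [if_pos h, if_pos (h.trans (hab i).le), sub_self,
      indicator_of_notMem fun h' => h'.1.not_ge h]
  · rw [if_neg h.not_ge, sub_zero]
    split_ifs with h'
    · rw [indicator_of_mem (show R.ev X ω ∈ halfOpen (a i) (b i) from ⟨h, h'⟩)]
    · rw [indicator_of_notMem fun h'' => h' h''.2]

theorem eventually_ev_of_hasStepIntegral {X : E} {F : ℝ → ℝ} {y : E}
    (h : HasStepIntegral e X F y) : ∀ᶠ ω in residual K, R.ev y ω = F (R.ev X ω) := by
  classical
  obtain ⟨n, c, S, m, -, -, hm, hF, rfl⟩ := h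
  filter_upwards [R.eventually_ev_sum Finset.univ fun i => c i • m i,
    eventually_countable_forall.2 fun i => R.eventually_ev_smul (c i) (m i),
    eventually_countable_forall.2 fun i => R.eventually_ev_of_hasSpectralMeasure (hm i)]
    with ω h1 h2 h3
  rw [h1, hF]
  refine Finset.sum_congr rfl fun i _ => ?_
  rw [h2, h3, indicator_apply, indicator_apply]
  split_ifs <;> simp

theorem eventually_eq_of_hasUpperIntegral {X : E} {g : ℝ → EReal} {u : R.SupCompletion}
    (h : R.HasUpperIntegral X g u) : ∀ᶠ ω in residual K, u.1 ω = g (R.ev X ω) := by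
  obtain ⟨F, y, hy, -, hF, hu⟩ := h
  obtain ⟨w, hw⟩ := CInf.exists_continuous_eventually_isLUB fun n => (R.toLin (y n)).1
  have hyw : ∀ n ω, R.toLin (y n) ω ≤ w ω := fun n =>
    CInf.le_of_eventually_le (u := (R.toLin (y n)).1) <| by
      filter_upwards [hw] with ω h using h.1 ⟨n, rfl⟩
  -- The continuous regularisation `w` of the pointwise supremum is the supremum in `E^s`.
  have hlub : IsLUB (range fun n => R.toSup (y n)) (⟨w, y 0, hyw 0⟩ : R.SupCompletion) := by
    refine ⟨?_, fun b hb => ?_⟩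
    · rintro _ ⟨n, rfl⟩
      exact hyw n
    · refine CInf.le_of_eventually_le ?_
      filter_upwards [hw] with ω h
      refine h.2 ?_
      rintro _ ⟨n, rfl⟩
      exact hb ⟨n, rfl⟩ ω
  have huw : u.1 = w := congrArg Subtype.val (hu.unique hlub)
  filter_upwards [hw, eventually_countable_forall.2 fun n =>
      CInf.eventually_coe_val (R.toLin (y n)),
    eventually_countable_forall.2 fun n => R.eventually_ev_of_hasStepIntegral (hy n)]
    with ω h1 h2 h3
  rw [huw]
  have h4 : ∀ n, (R.toLin (y n)).1 ω = (F n (R.ev X ω) : EReal) := fun n => by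
    rw [← h3]; exact h2 n
  simp only [h4] at h1
  exact h1.unique (hF _)

theorem eventually_val_of_hasDaniellIntegral {X : E} {f : ℝ → ℝ} {y : CInf K}
    (h : R.HasDaniellIntegral X f y) : ∀ᶠ ω in residual K, y.val ω = f (R.ev X ω) := by
  obtain ⟨g, h, v, w, v', w', -, -, hf, hv, hv', hw, hw', rfl⟩ := h
  filter_upwards [CInf.eventually_val_sub v w, R.eventually_eq_of_hasUpperIntegral hv,
    R.eventually_eq_of_hasUpperIntegral hw] with ω h1 h2 h3
  have h4 : v.val ω = g (R.ev X ω) := by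
    change (v.1 ω).toReal = _
    rw [← hv', h2, EReal.toReal_coe]
  have h5 : w.val ω = h (R.ev X ω) := by
    change (w.1 ω).toReal = _
    rw [← hw', h3, EReal.toReal_coe]
  rw [h1, h4, h5, hf]

end Ordered

end MaedaOgasawaraRep

/-! ### Continuous functions as increasing limits of step functions -/

/-- `F` is constant on each of the intervals `(p, q]` into which the finite set `P` divides `ℝ`:
two points with the same elements of `P` strictly below them have the same value. -/
def IsStepOn (P : Finset ℝ) (F : ℝ → ℝ) : Prop :=
  ∀ s t, (∀ p ∈ P, p < s ↔ p < t) → F s = F t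

theorem IsStepOn.sup {P Q : Finset ℝ} {F G : ℝ → ℝ} (hF : IsStepOn P F) (hG : IsStepOn Q G) :
    IsStepOn (P ∪ Q) (F ⊔ G) := fun s t h => by
  rw [Pi.sup_apply, Pi.sup_apply, hF s t fun p hp => h p (Finset.mem_union_left _ hp),
    hG s t fun p hp => h p (Finset.mem_union_right _ hp)]

theorem isStepOn_indicator_Ioc (a b c : ℝ) :
    IsStepOn {a, b} ((Ioc a b).indicator fun _ => c) := fun s t h => by
  have ha := h a (by simp)
  have hb := h b (by simp)
  have : s ∈ Ioc a b ↔ t ∈ Ioc a b := by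
    rw [mem_Ioc, mem_Ioc, ha, ← not_lt, hb, not_lt]
  by_cases hs : s ∈ Ioc a b
  · rw [indicator_of_mem hs, indicator_of_mem (this.1 hs)]
  · rw [indicator_of_notMem hs, indicator_of_notMem (mt this.2 hs)]

theorem exists_isStepOn_partialSups {φ : ℕ → ℝ → ℝ} (h : ∀ n, ∃ P, IsStepOn P (φ n)) (n : ℕ) :
    ∃ P, IsStepOn P (partialSups φ n) := by
  induction n with
  | zero => rw [partialSups_zero]; exact h 0
  | succ n ih =>
    obtain ⟨P, hP⟩ := ih
    obtain ⟨Q, hQ⟩ := h (n + 1)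
    rw [partialSups_add_one]
    exact ⟨P ∪ Q, hP.sup hQ⟩

/-- A nonnegative continuous function is the supremum of the countably many functions
`q · 1_{(a, b]}` with rational `a, b, q` that lie below it; the partial suprema of an enumeration
of these are step functions. -/
theorem exists_monotone_isStepOn {g : ℝ → ℝ} (hg : Continuous g) (hg0 : ∀ t, 0 ≤ g t) :
    ∃ F : ℕ → ℝ → ℝ, (∀ n, ∃ P, IsStepOn P (F n)) ∧ (∀ t, Monotone fun n => F n t) ∧
      (∀ t, IsLUB (range fun n => F n t) (g t)) := by
  let I := {i : ℚ × ℚ × ℚ // ∀ t ∈ Ioc (i.1 : ℝ) i.2.1, (i.2.2 : ℝ) ≤ g t}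
  have : Nonempty I := ⟨⟨(0, 0, 0), fun t _ => by simpa using hg0 t⟩⟩
  obtain ⟨enum, henum⟩ := exists_surjective_nat I
  let φ : ℕ → ℝ → ℝ := fun n =>
    (Ioc ((enum n).1.1 : ℝ) (enum n).1.2.1).indicator fun _ => ((enum n).1.2.2 : ℝ)
  refine ⟨partialSups φ, exists_isStepOn_partialSups fun n => ⟨_, isStepOn_indicator_Ioc _ _ _⟩,
    fun t m n hmn => (partialSups φ).monotone hmn t, fun t => ⟨?_, fun b hb => ?_⟩⟩
  · rintro _ ⟨n, rfl⟩
    refine partialSups_le φ n g (fun m _ s => ?_) t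
    by_cases hs : s ∈ Ioc ((enum m).1.1 : ℝ) (enum m).1.2.1
    · simp only [φ, indicator_of_mem hs]
      exact (enum m).2 s hs
    · simp only [φ, indicator_of_notMem hs]
      exact hg0 s
  · refine le_of_forall_lt fun r hr => ?_
    obtain ⟨q, hrq, hqg⟩ := exists_rat_btwn hr
    have hnhds : {s | (q : ℝ) < g s} ∈ 𝓝 t := (isOpen_lt continuous_const hg).mem_nhds hqg
    obtain ⟨l, u, ⟨hlt, htu⟩, hlu⟩ := mem_nhds_iff_exists_Ioo_subset.1 hnhds
    obtain ⟨a, hla, hat⟩ := exists_rat_btwn hlt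
    obtain ⟨c, htc, hcu⟩ := exists_rat_btwn htu
    obtain ⟨n, hn⟩ := henum ⟨(a, c, q), fun s hs =>
      le_of_lt (hlu ⟨hla.trans hs.1, hs.2.trans_lt hcu⟩)⟩
    have hφ : φ n t = q := by
      simp only [φ, hn]
      exact indicator_of_mem (show t ∈ Ioc (a : ℝ) c from ⟨hat, htc.le⟩) _
    exact hrq.trans_le ((hφ.symm.le.trans (le_partialSups φ n t)).trans (hb ⟨n, rfl⟩))

/-- The coercion to `EReal` preserves suprema of increasing sequences. -/
theorem isLUB_range_coe_ereal {u : ℕ → ℝ} (hu : Monotone u) {r : ℝ} (h : IsLUB (range u) r) :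
    IsLUB (range fun n => (u n : EReal)) (r : EReal) :=
  isLUB_of_tendsto_atTop (EReal.coe_strictMono.monotone.comp hu)
    ((continuous_coe_real_ereal.tendsto r).comp (tendsto_atTop_isLUB hu h))

section

variable {E : Type*} [ConditionallyCompleteLattice E] [AddCommGroup E] [Module ℝ E]

/-- The points of `P`, together with `±∞`, listed increasingly, bound a partition of `ℝ` into
intervals `(a_i, a_{i+1}]` on each of which the function is constant. -/
theorem IsStepOn.exists_hasStepIntegral {P : Finset ℝ} {F : ℝ → ℝ} (hF : IsStepOn P F) (e X : E) :
    ∃ y, HasStepIntegral e X F y := by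
  let Q : Finset EReal := insert ⊥ (insert ⊤ (P.image Real.toEReal))
  have hbotQ : ⊥ ∈ Q := by simp [Q]
  have htopQ : ⊤ ∈ Q := by simp [Q]
  obtain ⟨N, hN⟩ : ∃ N, Q.card = N + 1 :=
    Nat.exists_eq_succ_of_ne_zero (Finset.card_ne_zero_of_mem hbotQ)
  let a := Q.orderEmbOfFin hN
  have ha : ∀ x ∈ Q, ∃ j, a j = x := fun x hx => by
    have := Finset.range_orderEmbOfFin Q hN
    exact (Set.ext_iff.1 this x).2 hx
  let S : Fin N → Set ℝ := fun i => halfOpen (a i.castSucc) (a i.succ)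
  have hlt : ∀ i : Fin N, a i.castSucc < a i.succ := fun i =>
    a.strictMono Fin.castSucc_lt_succ
  have hdisj' : ∀ i j : Fin N, i < j → Disjoint (S i) (S j) := fun i j hij => by
    refine disjoint_left.2 fun t hi hj => ?_
    have : a i.succ ≤ a j.castSucc := a.monotone (by
      rw [Fin.le_def, Fin.val_succ, Fin.val_castSucc]; exact hij)
    exact (hi.2.trans this).not_gt hj.1
  have hdisj : Pairwise fun i j => Disjoint (S i) (S j) := fun i j hij => by
    rcases lt_or_gt_of_ne hij with h | h
    exacts [hdisj' i j h, (hdisj' j i h).symm]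
  have hcover : ∀ t : ℝ, ∃ i, t ∈ S i := fun t => by
    obtain ⟨j₀, hj₀⟩ := ha ⊥ hbotQ
    obtain ⟨j₁, hj₁⟩ := ha ⊤ htopQ
    -- The cell of `t` starts at the largest `a j` below `t`.
    let J : Finset (Fin (N + 1)) := Finset.univ.filter fun j => a j < t
    have hJ : J.Nonempty := ⟨j₀, by simp [J, hj₀]⟩
    have hmem : a (J.max' hJ) < t := (Finset.mem_filter.1 (J.max'_mem hJ)).2
    have hne : J.max' hJ ≠ Fin.last N := fun h => by
      have h1 : a j₁ ≤ a (J.max' hJ) := a.monotone (h ▸ Fin.le_last j₁)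
      rw [hj₁] at h1
      exact absurd (h1.trans_lt hmem) (by simp)
    refine ⟨(J.max' hJ).castPred hne, ?_, ?_⟩
    · rwa [Fin.castSucc_castPred]
    · by_contra! h
      have h1 := J.le_max' _ (Finset.mem_filter.2 ⟨Finset.mem_univ _, h⟩)
      have h2 : (((J.max' hJ).castPred hne).succ : Fin (N + 1)).val = (J.max' hJ).val + 1 := by
        simp
      rw [Fin.le_def, h2] at h1
      lia
  have hconst : ∀ i, ∀ s ∈ S i, ∀ t ∈ S i, F s = F t := fun i s hs t ht => by
    refine hF s t fun p hp => ?_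
    obtain ⟨j, hj⟩ := ha p (by simp [Q, hp])
    rw [← EReal.coe_lt_coe_iff, ← EReal.coe_lt_coe_iff, ← hj]
    rcases le_or_gt j i.castSucc with h | h
    · have := a.monotone h
      exact iff_of_true (this.trans_lt hs.1) (this.trans_lt ht.1)
    · have : a i.succ ≤ a j := a.monotone (Fin.castSucc_lt_iff_succ_le.1 h)
      exact iff_of_false (hs.2.trans this).not_gt (ht.2.trans this).not_gt
  choose k hk using hcover
  classical
  let c : Fin N → ℝ := fun i => if h : (S i).Nonempty then F h.some else 0
  refine ⟨_, N, c, S,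
    fun i => spectralSystemExt e X (a i.succ) - spectralSystemExt e X (a i.castSucc), hdisj,
    ?_, fun i => ?_, fun t => ?_, rfl⟩
  · exact eq_univ_of_forall fun t => mem_iUnion.2 ⟨k t, hk t⟩
  · exact ⟨1, fun _ => a i.castSucc, fun _ => a i.succ, fun _ => hlt i,
      fun x y hxy => absurd (Subsingleton.elim x y) hxy, (iUnion_const _).symm, by simp⟩
  · rw [Finset.sum_eq_single (k t), indicator_of_mem (hk t)]
    · have hne : (S (k t)).Nonempty := ⟨t, hk t⟩
      simp only [c, dif_pos hne]
      exact hconst _ _ (hk t) _ hne.some_mem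
    · intro i _ hi
      exact indicator_of_notMem (disjoint_left.1 (hdisj hi.symm) (hk t)) _
    · simp

end

namespace MaedaOgasawaraRep

variable {E : Type*} [ConditionallyCompleteLattice E] [AddCommGroup E] [Module ℝ E]
  {K : Type*} [TopologicalSpace K] [CompactSpace K] [T2Space K] [ExtremallyDisconnected K]
  {e : E} (R : MaedaOgasawaraRep e K)

/-! ### Unbounded order convergence implies generic pointwise convergence -/

/-- A sequence with infimum `0` in `E` has infimum `0` in `C^∞(K)` because `E` is order
dense, and infima of sequences in `C^∞(K)` are generically pointwise. -/
theorem eventually_isGLB_ev {z : ℕ → E} (hz : IsGLB (range z) 0) :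
    ∀ᶠ ω in residual K, IsGLB (range fun n => R.ev (z n) ω) 0 := by
  have hz0 : ∀ n, 0 ≤ R.toLin (z n) := fun n => by
    have := (R.le_iff _ _).1 (hz.1 ⟨n, rfl⟩)
    rwa [map_zero] at this
  obtain ⟨w, hw⟩ := CInf.exists_eventually_isGLB_val hz0
  have hw0 : 0 ≤ w := CInf.le_of_eventually_val_le <| by
    filter_upwards [hw, eventually_countable_forall.2 fun n => CInf.eventually_val_le (hz0 n)]
      with ω h1 h2
    refine h1.2 ?_
    rintro _ ⟨n, rfl⟩
    exact h2 n
  have hwz : ∀ n, w ≤ R.toLin (z n) := fun n => CInf.le_of_eventually_val_le <| by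
    filter_upwards [hw] with ω h using h.1 ⟨n, rfl⟩
  have : w = 0 := by
    by_contra hne
    obtain ⟨x, hx0, hxw⟩ := R.order_dense w (lt_of_le_of_ne hw0 (Ne.symm hne))
    have hx : x ≤ 0 := hz.2 <| by
      rintro _ ⟨n, rfl⟩
      exact (R.le_iff _ _).2 (hxw.trans (hwz n))
    have := (R.le_iff _ _).1 hx
    rw [map_zero] at this
    exact this.not_gt hx0
  filter_upwards [hw] with ω h
  rwa [this, CInf.val_zero] at h

theorem eventually_tendsto_ev [IsOrderedAddMonoid E] (he : 0 ≤ e) {x : ℕ → E} {x₀ : E}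
    (h : UOTendsto x x₀) :
    ∀ᶠ ω in residual K, Tendsto (fun n => R.ev (x n) ω) atTop (𝓝 (R.ev x₀ ω)) := by
  obtain ⟨z, hanti, hz, hle⟩ := h e he
  have hle' : ∀ n, |x n - x₀| ⊓ e ≤ z n := fun n => by
    have := (le_abs_self _).trans (hle n)
    rwa [sub_zero] at this
  filter_upwards [R.eventually_isGLB_ev hz,
    eventually_countable_forall.2 fun n => R.eventually_ev_le (hanti (Nat.le_succ n)),
    eventually_countable_forall.2 fun n => R.eventually_ev_le (hle' n),
    eventually_countable_forall.2 fun n => R.eventually_ev_inf |x n - x₀| e,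
    eventually_countable_forall.2 fun n => R.eventually_ev_abs (x n - x₀),
    eventually_countable_forall.2 fun n => R.eventually_ev_sub (x n) x₀]
    with ω h1 h2 h3 h4 h5 h6
  have hlim : Tendsto (fun n => R.ev (z n) ω) atTop (𝓝 0) :=
    tendsto_atTop_isGLB (antitone_nat_of_succ_le h2) h1
  have hbound : ∀ n, |R.ev (x n) ω - R.ev x₀ ω| ⊓ 1 ≤ R.ev (z n) ω := fun n => by
    rw [← h6, ← h5, ← R.ev_unit ω, ← h4]
    exact h3 n
  -- Once `z n < 1` at `ω`, truncation by the unit no longer matters.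
  rw [tendsto_iff_dist_tendsto_zero]
  refine squeeze_zero' (Eventually.of_forall fun n => dist_nonneg) ?_ hlim
  filter_upwards [hlim.eventually_lt_const one_pos] with n hn
  rw [Real.dist_eq]
  rcases inf_le_iff.1 (hbound n) with h | h
  · exact h
  · exact absurd hn h.not_gt

/-! ### Existence of the Daniell integral of a continuous function -/

/-- `g ∘ X` is continuous on the dense open set where `X` is finite and extends from there. -/
theorem exists_eventually_val_eq_comp (X : E) {g : ℝ → ℝ} (hg : Continuous g) :
    ∃ v : CInf K, ∀ᶠ ω in residual K, v.val ω = g (R.ev X ω) := by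
  have hF : ContinuousOn (fun ω => g (R.ev X ω)) (R.toLin X).fin :=
    hg.comp_continuousOn (R.toLin X).continuousOn_toReal
  refine ⟨CInf.extend (R.toLin X).isOpen_fin (R.toLin X).dense_fin hF, ?_⟩
  filter_upwards [residual_of_dense_open (R.toLin X).isOpen_fin (R.toLin X).dense_fin] with ω hω
  rw [CInf.val, CInf.extend_apply _ _ hF ω hω, EReal.toReal_coe]

variable [IsOrderedAddMonoid E]

theorem exists_hasUpperIntegral (X : E) {g : ℝ → ℝ} (hg : Continuous g) (hg0 : ∀ t, 0 ≤ g t) :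
    ∃ (v : CInf K) (v' : R.SupCompletion),
      R.HasUpperIntegral X (fun t => (g t : EReal)) v' ∧ v'.1 = v.1 := by
  obtain ⟨F, hstep, hmono, hlub⟩ := exists_monotone_isStepOn hg hg0
  choose P hP using hstep
  choose y hy using fun n => (hP n).exists_hasStepIntegral e X
  obtain ⟨v, hv⟩ := R.exists_eventually_val_eq_comp X hg
  have hy' := eventually_countable_forall.2 fun n => R.eventually_ev_of_hasStepIntegral (hy n)
  have hyv : ∀ n, R.toLin (y n) ≤ v := fun n => CInf.le_of_eventually_val_le <| by
    filter_upwards [hv, hy'] with ω h1 h2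
    change R.ev (y n) ω ≤ _
    rw [h1, h2]
    exact (hlub _).1 ⟨n, rfl⟩
  refine ⟨v, ⟨v.1, y 0, hyv 0⟩, ⟨F, y, hy, hmono, fun t => isLUB_range_coe_ereal (hmono t) (hlub t),
    ⟨?_, fun b hb => ?_⟩⟩, rfl⟩
  · rintro _ ⟨n, rfl⟩
    exact hyv n
  · refine CInf.le_of_eventually_le ?_
    filter_upwards [hv, hy', CInf.eventually_coe_val v,
      eventually_countable_forall.2 fun n => CInf.eventually_coe_val (R.toLin (y n))]
      with ω h1 h2 h3 h4
    change v ω ≤ _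
    rw [h3, h1]
    refine (isLUB_range_coe_ereal (hmono _) (hlub _)).2 ?_
    rintro _ ⟨n, rfl⟩
    have h5 : R.toLin (y n) ω ≤ b.1 ω := hb ⟨n, rfl⟩ ω
    rw [h4] at h5
    change ((R.ev (y n) ω : ℝ) : EReal) ≤ _ at h5
    rwa [h2] at h5

theorem existsUnique_hasDaniellIntegral (X : E) {f : ℝ → ℝ} (hf : Continuous f) :
    ∃! y : CInf K, R.HasDaniellIntegral X f y := by
  obtain ⟨v, v', hv, hv'⟩ := R.exists_hasUpperIntegral X (g := fun t => max (f t) 0)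
    (hf.max continuous_const) fun t => le_max_right _ _
  obtain ⟨w, w', hw, hw'⟩ := R.exists_hasUpperIntegral X (g := fun t => max (-f t) 0)
    (hf.neg.max continuous_const) fun t => le_max_right _ _
  have hvw : R.HasDaniellIntegral X f (v - w) :=
    ⟨_, _, v, w, v', w', fun t => le_max_right _ _, fun t => le_max_right _ _,
      fun t => (max_zero_sub_eq_self (f t)).symm, hv, hv', hw, hw', rfl⟩
  refine ⟨v - w, hvw, fun y hy => CInf.eq_of_eventually_val_eq ?_⟩
  filter_upwards [R.eventually_val_of_hasDaniellIntegral hy,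
    R.eventually_val_of_hasDaniellIntegral hvw] with ω h1 h2
  rw [h1, h2]

theorem eventually_val_funCalc (X : E) {f : ℝ → ℝ} (hf : Continuous f) :
    ∀ᶠ ω in residual K, (R.funCalc f X).val ω = f (R.ev X ω) := by
  have h := (R.existsUnique_hasDaniellIntegral X hf).exists
  rw [funCalc, dif_pos h]
  exact R.eventually_val_of_hasDaniellIntegral h.choose_spec

end MaedaOgasawaraRep

theorem mainTheorem8 {E : Type*} [ConditionallyCompleteLattice E] [AddCommGroup E]
    [IsOrderedAddMonoid E] [Module ℝ E] [IsOrderedModule ℝ E]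
    (e : E) (he : IsWeakUnit e)
    {K : Type*} [TopologicalSpace K] [CompactSpace K] [T2Space K] [ExtremallyDisconnected K]
    (R : MaedaOgasawaraRep e K)
    (f : ℝ → ℝ) (hf : Continuous f) :
    (∀ X : E, ∃! y : CInf K, R.HasDaniellIntegral X f y) ∧
    ∀ (x : ℕ → E) (x₀ : E), UOTendsto x x₀ →
      UOTendsto (fun n => R.funCalc f (x n)) (R.funCalc f x₀) := by
  refine ⟨fun X => R.existsUnique_hasDaniellIntegral X hf, fun x x₀ hx =>
    CInf.uoTendsto_of_eventually_tendsto_val ?_⟩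
  filter_upwards [R.eventually_tendsto_ev he.1 hx,
    eventually_countable_forall.2 fun n => R.eventually_val_funCalc (x n) hf,
    R.eventually_val_funCalc x₀ hf] with ω h1 h2 h3
  simp only [h2, h3]
  exact (hf.tendsto _).comp h1
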